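/- There is an absolute constant $c>0$ such that the following holds for every even $n\ge 2$. Let $\mathcal G_n$ be the set of directed graphs on the vertex set $\{1,\dots,n\}$ all of whose components are two-cycles with a self-loop at each vertex; that is, the graphs $G_\pi$ with edge set $\{(i,i),(i,\pi(i)) : 1\le i\le n\}$, where $\pi$ is a fixed-point-free involution of $\{1,\dots,n\}$. For $G\in\mathcal G_n$ label each edge $(i,j)$ by a distinct non-commuting variable $x_{i,j}$, and let $$\mathrm{C\text{-}perm}(G)=\sum_{\sigma\in S_n} a_{1,\sigma(1)}a_{2,\sigma(2)}\cdots a_{n,\sigma(n)},\qquad a_{i,j}=\begin{cases}x_{i,j}&\text{if }(i,j)\in E(G),\\0&\text{otherwise,}\end{cases}$$ be its Cayley permanent. An algebraic branching program (ABP) over a field $\mathbb K$ is a finite directed acyclic graph (parallel edges allowed) with two designated nodes $s,t$ and edges labelled by variables $x_{i,j}$ $(1\le i,j\le n)$ or constants from $\mathbb K$; its size is the number of its nodes, and it computes the sum, over all directed paths from $s$ to $t$, of the products of the edge labels in path order, as an element of the free algebra $\mathbb K\langle x_{i,j} : 1\le i,j\le n\rangle$. Then for all but at most a $1/\sqrt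 n$ fraction of the graphs $G\in\mathcal G_n$, every ABP, over any field, computing $\mathrm{C\text{-}perm}(G)$ has size at least $2^{cn}$. -/

import Mathlib

universe u v

noncomputable section

/-- A (non-commutative) algebraic branching program over the field `K` in the variables `X`: a
finite directed acyclic (multi)graph with two distinguished nodes `s`, `t`, each edge of which is
labelled by a variable or by a constant. -/
structure ABP (K : Type u) (X : Type v) where
  V : Type
  E : Type
  [fintypeV : Fintype V]
  [fintypeE : Fintype E]
  src : E → V
  tgt : E → V
  acyclic : ∀ x : V, ¬ Relation.TransGen (fun a b => ∃ e, src e = a ∧ tgt e = b) x x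
  label : E → X ⊕ K
  s : V
  t : V

namespace ABP

attribute [instance] ABP.fintypeV ABP.fintypeE

variable {K : Type u} {X : Type v}

/-- The size of a branching program is its number of nodes. -/
def size (P : ABP K X) : ℕ := Fintype.card P.V

/-- `P.IsPath a l b`: the edges in the list `l`, in this order, form a directed path
from `a` to `b`. -/
def IsPath (P : ABP K X) : P.V → List P.E → P.V → Prop
  | a, [], b => a = b
  | a, e :: l, b => P.src e = a ∧ IsPath P (P.tgt e) l b

/-- The set of all directed paths from `s` to `t`. -/
def paths (P : ABP K X) : Set (List P.E) := {l | P.IsPath P.s l P.t}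

theorem IsPath.transGen_of_mem (P : ABP K X) {l : List P.E} {a b : P.V} (h : P.IsPath a l b)
    {e : P.E} (he : e ∈ l) :
    Relation.TransGen (fun a b => ∃ e, P.src e = a ∧ P.tgt e = b) a (P.tgt e) := by
  induction l generalizing a with
  | nil => simp at he
  | cons f l ih =>
    obtain ⟨h1, h2⟩ := h
    rcases List.mem_cons.1 he with rfl | he
    · exact Relation.TransGen.single ⟨e, h1, rfl⟩
    · exact Relation.TransGen.head ⟨f, h1, rfl⟩ (ih h2 he)

theorem IsPath.nodup (P : ABP K X) {l : List P.E} {a b : P.V} (h : P.IsPath a l b) :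
    (l.map P.tgt).Nodup := by
  induction l generalizing a with
  | nil => simp
  | cons f l ih =>
    obtain ⟨h1, h2⟩ := h
    rw [List.map_cons, List.nodup_cons]
    refine ⟨fun hf => ?_, ih h2⟩
    obtain ⟨e, he, hef⟩ := List.mem_map.1 hf
    have := IsPath.transGen_of_mem P h2 he
    rw [hef] at this
    exact P.acyclic _ this

theorem paths_finite (P : ABP K X) : P.paths.Finite := by
  refine (List.finite_length_le P.E (Fintype.card P.V)).subset fun l hl => ?_
  have := (IsPath.nodup P hl).length_le_card
  simpa using this

variable [Field K]

/-- The weight of an edge, as an element of the free algebra `K⟨X⟩`. -/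
def edgeWeight (P : ABP K X) (e : P.E) : FreeAlgebra K X :=
  Sum.elim (FreeAlgebra.ι K) (algebraMap K (FreeAlgebra K X)) (P.label e)

/-- The polynomial computed by `P`: the sum over all directed paths from `s` to `t` of the
products of the edge weights, multiplied in the order of the path. -/
def poly (P : ABP K X) : FreeAlgebra K X :=
  ∑ l ∈ P.paths_finite.toFinset, (l.map P.edgeWeight).prod

end ABP

/-- The Cayley permanent `∑ σ, A 1 (σ 1) * ⋯ * A n (σ n)`, each product being taken in the order
of the rows. -/
def cayleyPermanent {R : Type*} [Semiring R] {n : ℕ} (A : Matrix (Fin n) (Fin n) R) : R :=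
  ∑ σ : Equiv.Perm (Fin n), (List.ofFn fun i => A i (σ i)).prod

open Classical in
/-- The weighted adjacency matrix of a directed graph whose edges `(i, j)` are labelled by
distinct non-commuting variables `x_{i,j}`. -/
def weightedAdjMatrix (K : Type u) [Field K] {n : ℕ} (G : Digraph (Fin n)) :
    Matrix (Fin n) (Fin n) (FreeAlgebra K (Fin n × Fin n)) :=
  fun i j => if G.Adj i j then FreeAlgebra.ι K (i, j) else 0

/-- The Cayley permanent of a directed graph with distinct edge variables. -/
def cayleyPermanentGraph (K : Type u) [Field K] {n : ℕ} (G : Digraph (Fin n)) :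
    FreeAlgebra K (Fin n × Fin n) :=
  cayleyPermanent (weightedAdjMatrix K G)

/-- The graph of an involution `π`: the two-cycles of `π`, with a self loop at every vertex. -/
def involutionGraph {n : ℕ} (π : Equiv.Perm (Fin n)) : Digraph (Fin n) where
  Adj i j := j = i ∨ j = π i

/-- The labelled directed graphs on `n` vertices all of whose components are two-cycles, with a
self loop at every vertex. -/
def twoCycleGraphs (n : ℕ) : Set (Digraph (Fin n)) :=
  {G | ∃ π : Equiv.Perm (Fin n), (∀ i, π (π i) = i) ∧ (∀ i, π i ≠ i) ∧ G = involutionGraph π}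

end

/-!
The lower bound is Nisan's rank argument. For a word `u`, consider the function that sends a word
`w` to the coefficient of `u ++ w` in the polynomial computed by a branching program. All these
functions lie in the span of the coefficient functions of the polynomials computed from the nodes
to the sink, since this span is closed under fixing the first letter of the word
(`ABP.cons_coeff_mem_coeffSpan`, by induction along the acyclic graph). So the rank of the matrix
of the coefficients of `u ++ v` is at most the number of nodes, and no homogeneity of the program
is needed (`ABP.card_le_size_of_wordCoeff`).

The Cayley permanent of a graph of two-cycles is an interleaved product of the polynomials
`x_{i,i} x_{j,j} + x_{i,j} x_{j,i}`, one for each cycle `{i, j}`. If the words are cut in the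
middle, each two-cycle with one point on either side contributes a factor two to the rank, so the
size is at least two to the number of split cycles (`two_pow_crossing_le_size`).

It remains to see that few involutions have few split cycles. By conjugation, the average over
all involutions of `r ^ (number of split cycles)` for the fixed set `{0, …, m - 1}` equals the
average over all `m`-sets for a fixed involution (`sum_pow_crossing_eq`). Over all sets, the
two-cycles are split independently, which gives the sum `(2 + 2 * r) ^ m`; the `m`-sets are at
least a `1 / (2 * m)` fraction of all sets. Markov's inequality with `r = 1 / 4` then bounds the
exceptional fraction by `2 * m * (3 / 4) ^ m`, which is at most `1 / √(2 * m)` for `m ≥ 20`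
(`card_few_crossing_le`). For smaller `m` no graph is exceptional, because every program for a
Cayley permanent has at least two nodes (`two_le_size`).
-/

/-! ### Coefficients of words in the free algebra -/

section WordCoeff

variable {K : Type u} {X : Type v} [Field K]

open Classical in
/-- Left multiplication by the variable `x`, on formal series `List X → K` in non-commuting
variables. -/
noncomputable def prependVar (x : X) : Module.End K (List X → K) where
  toFun g w := match w with
    | [] => 0
    | y :: w => if y = x then g w else 0
  map_add' g h := by
    funext w
    cases w with
    | nil => simp
    | cons y w => by_cases hy : y = x <;> simp [hy]
  map_smul' c g := by
    funext w
    cases w with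
    | nil => simp
    | cons y w => by_cases hy : y = x <;> simp [hy]

open Classical in
/-- The coefficients of an element of the free algebra, as a function of the word. They are read
off from the action of the free algebra on formal series, applied to the series `1`. -/
noncomputable def wordCoeff (K : Type u) (X : Type v) [Field K] : FreeAlgebra K X →ₗ[K] (List X → K) :=
  LinearMap.applyₗ (Pi.single [] 1) ∘ₗ (FreeAlgebra.lift K (prependVar (K := K))).toLinearMap

theorem wordCoeff_one_nil : wordCoeff K X 1 [] = 1 := by
  simp [wordCoeff]

theorem wordCoeff_one_cons (x : X) (w : List X) : wordCoeff K X 1 (x :: w) = 0 := by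
  simp [wordCoeff]

theorem wordCoeff_ι_mul_nil (x : X) (p : FreeAlgebra K X) :
    wordCoeff K X (FreeAlgebra.ι K x * p) [] = 0 := by
  simp [wordCoeff, prependVar]

open Classical in
theorem wordCoeff_ι_mul_cons (x y : X) (p : FreeAlgebra K X) (w : List X) :
    wordCoeff K X (FreeAlgebra.ι K x * p) (y :: w) = if y = x then wordCoeff K X p w else 0 := by
  simp [wordCoeff, prependVar]

open Classical in
theorem wordCoeff_prod_ofFn {n : ℕ} (p : Fin n → Prop) (y : Fin n → X) (w : List X) :
    wordCoeff K X (List.ofFn fun i => if p i then FreeAlgebra.ι K (y i) else 0).prod w =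
      if (∀ i, p i) ∧ w = List.ofFn y then 1 else 0 := by
  induction n generalizing w with
  | zero =>
    cases w with
    | nil => simp [wordCoeff_one_nil]
    | cons x w => simp [wordCoeff_one_cons]
  | succ n ih =>
    rw [List.ofFn_succ, List.prod_cons]
    by_cases h0 : p 0
    · rw [if_pos h0]
      cases w with
      | nil => simp [wordCoeff_ι_mul_nil]
      | cons x w =>
        rw [wordCoeff_ι_mul_cons, ih (fun i => p i.succ) (fun i => y i.succ), ← ite_and]
        refine if_congr ?_ rfl rfl
        rw [Fin.forall_fin_succ, List.ofFn_succ, List.cons.injEq]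
        tauto
    · rw [if_neg h0, zero_mul, map_zero, if_neg fun h => h0 (h.1 0)]
      rfl

end WordCoeff

/-! ### Branching programs and the rank of coefficient matrices -/

namespace ABP

variable {K : Type u} {X : Type v}

/-- The branching program `P` with its source moved to the node `q`. -/
def withSource (P : ABP K X) (q : P.V) : ABP K X := { P with s := q }

theorem isPath_withSource (P : ABP K X) (q a b : P.V) (l : List P.E) :
    (P.withSource q).IsPath a l b ↔ P.IsPath a l b := by
  induction l generalizing a with
  | nil => exact Iff.rfl
  | cons e l ih => exact and_congr_right fun _ => ih (P.tgt e)

/-- Induction on the nodes of a branching program, from the sinks backwards. -/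
theorem node_induction (P : ABP K X) {C : P.V → Prop}
    (h : ∀ q, (∀ e, P.src e = q → C (P.tgt e)) → C q) (q : P.V) : C q := by
  let r : P.V → P.V → Prop :=
    fun a b => Relation.TransGen (fun a b => ∃ e, P.src e = a ∧ P.tgt e = b) b a
  have : IsTrans P.V r := ⟨fun _ _ _ hab hbc => hbc.trans hab⟩
  have : Std.Irrefl r := ⟨P.acyclic⟩
  have hwf : WellFounded r := Finite.wellFounded_of_trans_of_irrefl r
  refine hwf.induction q fun q ih => h q fun e he => ih _ ?_
  exact Relation.TransGen.single ⟨e, he, rfl⟩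

variable [Field K]

/-- The polynomial computed by `P` from the node `q` to the sink. -/
noncomputable def polyFrom (P : ABP K X) (q : P.V) : FreeAlgebra K X := (P.withSource q).poly

open Classical in
/-- Splitting off the first edge of a path. -/
theorem polyFrom_eq (P : ABP K X) (q : P.V) :
    P.polyFrom q = (if q = P.t then 1 else 0) +
      ∑ e with P.src e = q, P.edgeWeight e * P.polyFrom (P.tgt e) := by
  let S : P.V → Finset (List P.E) := fun a => (P.withSource a).paths_finite.toFinset
  have hS : ∀ a l, l ∈ S a ↔ P.IsPath a l P.t := fun a l =>
    (Set.Finite.mem_toFinset _).trans (P.isPath_withSource a a P.t l)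
  have hp : ∀ a, P.polyFrom a = ∑ l ∈ S a, (l.map P.edgeWeight).prod := fun a => rfl
  have hq : S q = (if q = P.t then {[]} else ∅) ∪
      (Finset.univ.filter fun e => P.src e = q).biUnion
        fun e => (S (P.tgt e)).image (List.cons e) := by
    ext l
    rw [hS]
    cases l with
    | nil => by_cases h : q = P.t <;> simp [IsPath, h]
    | cons e l => by_cases h : q = P.t <;> simp [IsPath, h, hS]
  rw [hp, hq, Finset.sum_union, Finset.sum_biUnion]
  · congr 1
    · by_cases h : q = P.t <;> simp [h]
    · refine Finset.sum_congr rfl fun e _ => ?_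
      rw [Finset.sum_image (by simp), hp, Finset.mul_sum]
      simp
  · intro e _ f _ hef
    rw [Function.onFun, Finset.disjoint_left]
    intro l hl hl'
    obtain ⟨l₁, _, rfl⟩ := Finset.mem_image.1 hl
    obtain ⟨l₂, _, h⟩ := Finset.mem_image.1 hl'
    exact hef (List.cons.inj h).1.symm
  · rw [Finset.disjoint_left]
    intro l hl hl'
    by_cases h : q = P.t
    · rw [if_pos h, Finset.mem_singleton] at hl
      simp [hl] at hl'
    · simp [h] at hl

/-- The space spanned by the coefficient functions of the polynomials computed from the nodes
of `P` to the sink. -/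
noncomputable def coeffSpan (P : ABP K X) : Submodule K (List X → K) :=
  Submodule.span K (Set.range fun q => wordCoeff K X (P.polyFrom q))

/-- A node contributes the functions of its successors: those behind an edge labelled `x`
directly, those behind a constant edge by induction. -/
theorem cons_coeff_mem_coeffSpan (P : ABP K X) (x : X) (q : P.V) :
    (fun w => wordCoeff K X (P.polyFrom q) (x :: w)) ∈ P.coeffSpan := by
  classical
  induction q using P.node_induction with
  | h q ih =>
  have h1 : (fun w => wordCoeff K X (P.polyFrom q) (x :: w)) =
      ∑ e with P.src e = q,
        fun w => wordCoeff K X (P.edgeWeight e * P.polyFrom (P.tgt e)) (x :: w) := by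
    funext w
    rw [polyFrom_eq, map_add, map_sum, Pi.add_apply, Finset.sum_apply, Finset.sum_apply]
    by_cases h : q = P.t <;> simp [h, wordCoeff_one_cons]
  rw [h1]
  refine Submodule.sum_mem _ fun e he => ?_
  have ihe := ih e (Finset.mem_filter.1 he).2
  rcases hl : P.label e with y | c
  · by_cases hxy : x = y
    · simp only [edgeWeight, hl, Sum.elim_inl, wordCoeff_ι_mul_cons, if_pos hxy]
      exact Submodule.subset_span ⟨P.tgt e, rfl⟩
    · simp only [edgeWeight, hl, Sum.elim_inl, wordCoeff_ι_mul_cons, if_neg hxy]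
      exact P.coeffSpan.zero_mem
  · simp only [edgeWeight, hl, Sum.elim_inr, ← Algebra.smul_def, map_smul]
    exact P.coeffSpan.smul_mem c ihe

theorem append_mem_coeffSpan (P : ABP K X) (u : List X) {g : List X → K}
    (hg : g ∈ P.coeffSpan) : (fun w => g (u ++ w)) ∈ P.coeffSpan := by
  induction u generalizing g with
  | nil => exact hg
  | cons x u ih =>
    refine ih (g := fun w => g (x :: w)) ?_
    induction hg using Submodule.span_induction with
    | mem g hg =>
      obtain ⟨q, rfl⟩ := hg
      exact P.cons_coeff_mem_coeffSpan x q
    | zero => exact P.coeffSpan.zero_mem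
    | add g h _ _ hg hh => exact P.coeffSpan.add_mem hg hh
    | smul c g _ hg => exact P.coeffSpan.smul_mem c hg

/-- Nisan's lower bound, in the case where the coefficient matrix `(u, v) ↦ [u ++ v] P.poly`
contains an identity matrix with rows and columns indexed by `ι`. -/
theorem card_le_size_of_wordCoeff (P : ABP K X) {ι : Type*} [Fintype ι] [DecidableEq ι]
    (u v : ι → List X)
    (h : ∀ i j, wordCoeff K X P.poly (u i ++ v j) = if i = j then 1 else 0) :
    Fintype.card ι ≤ P.size := by
  let g : ι → P.coeffSpan := fun i =>
    ⟨fun w => wordCoeff K X P.poly (u i ++ w),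
      P.append_mem_coeffSpan (u i) (Submodule.subset_span ⟨P.s, rfl⟩)⟩
  have hg : LinearIndependent K g := by
    rw [Fintype.linearIndependent_iff]
    intro a ha j
    have := congrFun (congrArg Subtype.val ha) (v j)
    simpa [g, Finset.sum_apply, h] using this
  have hfin : FiniteDimensional K P.coeffSpan :=
    FiniteDimensional.span_of_finite K (Set.finite_range _)
  exact hg.fintype_card_le_finrank.trans (finrank_range_le_card _)

end ABP

/-! ### Pairs of an involution split by a set -/

/-- The number of points of `S` that `π` moves out of `S`; for an involution, the number of
two-cycles split by `S`. -/
def crossing {α : Type*} [Fintype α] [DecidableEq α] (π : Equiv.Perm α) (S : Finset α) : ℕ :=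
  (Finset.univ.filter fun i => i ∈ S ∧ π i ∉ S).card

theorem crossing_conj {α : Type*} [Fintype α] [DecidableEq α] (σ π : Equiv.Perm α)
    (S : Finset α) : crossing (σ * π * σ⁻¹) (S.map σ.toEmbedding) = crossing π S := by
  refine Finset.card_equiv σ⁻¹ fun i => ?_
  simp [Finset.mem_map_equiv]

/-- The fixed-point-free involutions. -/
def fpfInvolutions (α : Type*) [Fintype α] [DecidableEq α] : Finset (Equiv.Perm α) :=
  Finset.univ.filter fun π => (∀ i, π (π i) = i) ∧ ∀ i, π i ≠ i

theorem mem_fpfInvolutions {α : Type*} [Fintype α] [DecidableEq α] {π : Equiv.Perm α} :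
    π ∈ fpfInvolutions α ↔ (∀ i, π (π i) = i) ∧ ∀ i, π i ≠ i := by
  simp [fpfInvolutions]

theorem conj_mem_fpfInvolutions {α : Type*} [Fintype α] [DecidableEq α] (σ π : Equiv.Perm α) :
    σ * π * σ⁻¹ ∈ fpfInvolutions α ↔ π ∈ fpfInvolutions α := by
  simp only [mem_fpfInvolutions]
  refine and_congr ?_ ?_
  · rw [← σ.forall_congr_right]
    simp
  · rw [← σ.forall_congr_right]
    simp

theorem Finset.exists_perm_map_eq {α : Type*} [Fintype α] [DecidableEq α] {S T : Finset α}
    (h : S.card = T.card) : ∃ σ : Equiv.Perm α, S.map σ.toEmbedding = T := by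
  let e : {x // x ∈ S} ≃ {x // x ∈ T} := Finset.equivOfCardEq h
  refine ⟨e.extendSubtype, Finset.eq_of_subset_of_card_le ?_ (by simp [h])⟩
  intro x hx
  obtain ⟨y, hy, rfl⟩ := Finset.mem_map.1 hx
  exact e.extendSubtype_mem y hy

theorem sum_pow_crossing_eq {α : Type*} [Fintype α] [DecidableEq α] (r : ℝ) {S T : Finset α}
    (h : S.card = T.card) :
    ∑ π ∈ fpfInvolutions α, r ^ crossing π S = ∑ π ∈ fpfInvolutions α, r ^ crossing π T := by
  obtain ⟨σ, rfl⟩ := Finset.exists_perm_map_eq h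
  refine Finset.sum_equiv (MulAut.conj σ).toEquiv (fun π => ?_) fun π _ => ?_
  · exact (conj_mem_fpfInvolutions σ π).symm
  · exact congrArg (r ^ ·) (crossing_conj σ π S).symm

/-- For a fixed involution, a uniformly random set splits its two-cycles independently. -/
theorem sum_finset_pow_crossing_le {m : ℕ} {π : Equiv.Perm (Fin (m + m))}
    (hπ : π ∈ fpfInvolutions (Fin (m + m))) {r : ℝ} (h0 : 0 ≤ r) (h1 : r ≤ 1) :
    ∑ S : Finset (Fin (m + m)), r ^ crossing π S ≤ (2 + 2 * r) ^ m := by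
  obtain ⟨hinv, hne⟩ := mem_fpfInvolutions.1 hπ
  -- `A` holds the smaller element of each two-cycle.
  let A : Finset (Fin (m + m)) := Finset.univ.filter fun i => i < π i
  have hmem : ∀ i, i ∈ A ↔ i < π i := fun i => by simp [A]
  have hA : A.card ≤ m := by
    have hdisj : Disjoint A (A.map π.toEmbedding) := by
      rw [Finset.disjoint_left]
      intro i hi hi'
      obtain ⟨j, hj, rfl⟩ := Finset.mem_map.1 hi'
      have h2 := (hmem _).1 hi
      have h3 := (hmem _).1 hj
      simp only [Equiv.coe_toEmbedding, hinv] at h2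
      exact lt_asymm h2 h3
    have := Finset.card_le_univ (A ∪ A.map π.toEmbedding)
    rw [Finset.card_union_of_disjoint hdisj, Finset.card_map, Fintype.card_fin] at this
    lia
  let weight : Bool × Bool → ℝ := fun b => if b.1 = b.2 then 1 else r
  let code : Finset (Fin (m + m)) → (A → Bool × Bool) :=
    fun S i => (decide (i.1 ∈ S), decide (π i.1 ∈ S))
  have hcode : Function.Injective code := by
    intro S T hST
    ext i
    rcases lt_or_gt_of_ne (hne i) with hi | hi
    · have := congrFun hST ⟨π i, (hmem _).2 (by rwa [hinv])⟩
      simpa [code, hinv] using (Prod.ext_iff.1 this).2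
    · have := congrFun hST ⟨i, (hmem _).2 hi⟩
      simpa [code] using (Prod.ext_iff.1 this).1
  have hle : ∀ S, r ^ crossing π S ≤ ∏ i, weight (code S i) := by
    intro S
    have hprod : ∏ i, weight (code S i) =
        r ^ (A.filter fun i => ¬(i ∈ S ↔ π i ∈ S)).card := by
      rw [← Finset.prod_const, Finset.prod_filter, ← Finset.prod_coe_sort A]
      refine Finset.prod_congr rfl fun i _ => ?_
      by_cases ha : i.1 ∈ S <;> by_cases hb : π i.1 ∈ S <;> simp [weight, code, ha, hb]
    rw [hprod]
    refine pow_le_pow_of_le_one h0 h1 ?_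
    refine Finset.card_le_card_of_injOn (fun i => if i ∈ S then i else π i) ?_ ?_
    · intro i hi
      have hi := (Finset.mem_filter.1 hi).2
      by_cases ha : i ∈ S
      · simp only [ha, true_iff] at hi
        simp [ha, hi]
      · simp only [ha, false_iff, not_not] at hi
        simp [ha, hi, hinv]
    · intro i hi j hj hij
      have hi := (hmem _).1 (Finset.mem_filter.1 hi).1
      have hj := (hmem _).1 (Finset.mem_filter.1 hj).1
      by_cases ha : i ∈ S <;> by_cases hb : j ∈ S <;> simp only [ha, hb, if_true, if_false] at hij
      · exact hij
      · rw [hij, hinv] at hi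
        exact absurd hi (lt_asymm hj)
      · rw [← hij, hinv] at hj
        exact absurd hj (lt_asymm hi)
      · exact π.injective hij
  have hw : ∀ b, 0 ≤ weight b := fun b => by
    simp only [weight]
    split_ifs
    exacts [zero_le_one, h0]
  calc ∑ S, r ^ crossing π S
      ≤ ∑ S, ∏ i, weight (code S i) := Finset.sum_le_sum fun S _ => hle S
    _ = ∑ g ∈ Finset.univ.image code, ∏ i, weight (g i) :=
        (Finset.sum_image (f := fun g : A → Bool × Bool => ∏ i, weight (g i)) hcode.injOn).symm
    _ ≤ ∑ g : A → Bool × Bool, ∏ i, weight (g i) :=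
        Finset.sum_le_sum_of_subset_of_nonneg (Finset.subset_univ _)
          fun g _ _ => Finset.prod_nonneg fun i _ => hw _
    _ = ∏ _i : A, ∑ b, weight b := (Fintype.prod_sum fun (_ : A) b => weight b).symm
    _ = (2 + 2 * r) ^ A.card := by
        rw [Finset.prod_const, Finset.card_univ, Fintype.card_coe]
        congr 1
        simp [Fintype.sum_prod_type, weight]
        ring
    _ ≤ (2 + 2 * r) ^ m := pow_le_pow_right₀ (by linarith) hA

/-- The exponential moment of the number of split pairs, over a uniformly random
fixed-point-free involution and a fixed set of half the size. The average over the involutions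
equals an average over the sets of that size, which are a `1 / (2 * m)` fraction of all sets at
least. -/
theorem sum_pow_crossing_le {m : ℕ} (hm : 0 < m) {S : Finset (Fin (m + m))} (hS : S.card = m)
    {r : ℝ} (h0 : 0 ≤ r) (h1 : r ≤ 1) :
    ∑ π ∈ fpfInvolutions (Fin (m + m)), r ^ crossing π S ≤
      2 * m * ((1 + r) / 2) ^ m * (fpfInvolutions (Fin (m + m))).card := by
  set I := fpfInvolutions (Fin (m + m))
  set E := ∑ π ∈ I, r ^ crossing π S
  have hE : 0 ≤ E := Finset.sum_nonneg fun _ _ => pow_nonneg h0 _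
  have hchoose : (m.centralBinom : ℝ) * E ≤ (2 + 2 * r) ^ m * I.card := by
    calc (m.centralBinom : ℝ) * E
        = ∑ T ∈ Finset.univ.powersetCard m, ∑ π ∈ I, r ^ crossing π T := by
          rw [Finset.sum_congr rfl fun T hT => sum_pow_crossing_eq r
            ((Finset.mem_powersetCard.1 hT).2.trans hS.symm), Finset.sum_const,
            Finset.card_powersetCard, Finset.card_univ, Fintype.card_fin, nsmul_eq_mul,
            Nat.centralBinom, two_mul]
      _ = ∑ π ∈ I, ∑ T ∈ Finset.univ.powersetCard m, r ^ crossing π T := Finset.sum_comm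
      _ ≤ ∑ π ∈ I, ∑ T, r ^ crossing π T := Finset.sum_le_sum fun π _ =>
          Finset.sum_le_sum_of_subset_of_nonneg (Finset.subset_univ _)
            fun _ _ _ => pow_nonneg h0 _
      _ ≤ ∑ π ∈ I, (2 + 2 * r) ^ m :=
          Finset.sum_le_sum fun π hπ => sum_finset_pow_crossing_le hπ h0 h1
      _ = (2 + 2 * r) ^ m * I.card := by rw [Finset.sum_const, nsmul_eq_mul, mul_comm]
  have hbinom : (4 : ℝ) ^ m ≤ 2 * m * m.centralBinom := by
    exact_mod_cast Nat.four_pow_le_two_mul_self_mul_centralBinom m hm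
  have h4 : (4 : ℝ) ^ m * E ≤ 4 ^ m * (2 * m * ((1 + r) / 2) ^ m * I.card) := by
    calc (4 : ℝ) ^ m * E ≤ 2 * m * m.centralBinom * E := by gcongr
      _ = 2 * m * (m.centralBinom * E) := by ring
      _ ≤ 2 * m * ((2 + 2 * r) ^ m * I.card) := by gcongr
      _ = 4 ^ m * (2 * m * ((1 + r) / 2) ^ m * I.card) := by
          rw [show 2 + 2 * r = 4 * ((1 + r) / 2) by ring, mul_pow]
          ring
  exact le_of_mul_le_mul_left h4 (by positivity)

theorem two_mul_cube_le {m : ℕ} (hm : 20 ≤ m) : (2 * m : ℝ) ^ 3 ≤ (16 / 9) ^ m := by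
  induction m, hm using Nat.le_induction with
  | base => norm_num
  | succ m hm ih =>
    have h : (20 : ℝ) ≤ m := by exact_mod_cast hm
    have : (2 * (m + 1) : ℝ) ^ 3 ≤ 16 / 9 * (2 * m) ^ 3 := by nlinarith [sq_nonneg (m : ℝ)]
    push_cast
    rw [pow_succ (16 / 9 : ℝ)]
    linarith

theorem two_mul_mul_pow_le {m : ℕ} (hm : 20 ≤ m) :
    2 * m * (3 / 4 : ℝ) ^ m ≤ 1 / √(m + m : ℝ) := by
  have hpos : (0 : ℝ) < m + m := by
    have : (20 : ℝ) ≤ m := by exact_mod_cast hm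
    linarith
  rw [le_div_iff₀ (Real.sqrt_pos.2 hpos)]
  refine le_of_sq_le_sq ?_ zero_le_one
  rw [mul_pow, mul_pow, Real.sq_sqrt hpos.le, ← pow_mul, mul_comm m 2, pow_mul]
  calc (2 * m : ℝ) ^ 2 * ((3 / 4) ^ 2) ^ m * (m + m) = (2 * m) ^ 3 * (9 / 16) ^ m := by
        norm_num; ring
    _ ≤ (16 / 9) ^ m * (9 / 16) ^ m := by gcongr; exact two_mul_cube_le hm
    _ = 1 ^ 2 := by rw [← mul_pow]; norm_num

/-- Few fixed-point-free involutions have at most `m / 8` pairs split by a set of half the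
size. -/
theorem card_few_crossing_le {m : ℕ} (hm : 20 ≤ m) {S : Finset (Fin (m + m))}
    (hS : S.card = m) :
    (((fpfInvolutions (Fin (m + m))).filter fun π => 8 * crossing π S ≤ m).card : ℝ) ≤
      1 / √(m + m : ℝ) * (fpfInvolutions (Fin (m + m))).card := by
  set I := fpfInvolutions (Fin (m + m))
  -- Since `4 ≤ (6/5) ^ 8`, each counted involution has weight `(6/5) ^ m * (1/4) ^ crossing ≥ 1`.
  have hone : ∀ π ∈ I.filter fun π => 8 * crossing π S ≤ m,
      1 ≤ (6 / 5 : ℝ) ^ m * (1 / 4) ^ crossing π S := by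
    intro π hπ
    calc (1 : ℝ) = 4 ^ crossing π S * (1 / 4) ^ crossing π S := by rw [← mul_pow]; norm_num
      _ ≤ ((6 / 5) ^ 8) ^ crossing π S * (1 / 4) ^ crossing π S := by gcongr; norm_num
      _ ≤ (6 / 5) ^ m * (1 / 4) ^ crossing π S := by
          rw [← pow_mul]
          gcongr
          · norm_num
          · exact (Finset.mem_filter.1 hπ).2
  calc ((I.filter fun π => 8 * crossing π S ≤ m).card : ℝ)
      = ∑ π ∈ I.filter fun π => 8 * crossing π S ≤ m, 1 := by simp
    _ ≤ ∑ π ∈ I.filter fun π => 8 * crossing π S ≤ m,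
          (6 / 5 : ℝ) ^ m * (1 / 4) ^ crossing π S := Finset.sum_le_sum hone
    _ ≤ ∑ π ∈ I, (6 / 5 : ℝ) ^ m * (1 / 4) ^ crossing π S :=
        Finset.sum_le_sum_of_subset_of_nonneg (Finset.filter_subset _ _)
          fun _ _ _ => by positivity
    _ = (6 / 5 : ℝ) ^ m * ∑ π ∈ I, (1 / 4) ^ crossing π S := Finset.mul_sum _ _ _ |>.symm
    _ ≤ (6 / 5 : ℝ) ^ m * (2 * m * ((1 + 1 / 4) / 2) ^ m * I.card) := by
        gcongr
        exact sum_pow_crossing_le (by lia) hS (by norm_num) (by norm_num)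
    _ = 2 * m * (6 / 5 * ((1 + 1 / 4) / 2) : ℝ) ^ m * I.card := by rw [mul_pow]; ring
    _ = 2 * m * (3 / 4 : ℝ) ^ m * I.card := by norm_num
    _ ≤ 1 / √(m + m : ℝ) * I.card := by
        gcongr
        exact two_mul_mul_pow_le hm

/-! ### The Cayley permanent of a graph of two-cycles -/

section TwoCycles

variable {K : Type u} [Field K]

/-- The word `(0, f 0) (1, f 1) ⋯` of a function `f`. -/
def rowWord {n : ℕ} (f : Fin n → Fin n) : List (Fin n × Fin n) := List.ofFn fun i => (i, f i)

theorem rowWord_injective {n : ℕ} : Function.Injective (rowWord (n := n)) := by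
  intro f g h
  funext i
  exact (Prod.ext_iff.1 (congrFun (List.ofFn_injective h) i)).2

open Classical in
theorem wordCoeff_cayleyPermanentGraph {n : ℕ} (G : Digraph (Fin n))
    (w : List (Fin n × Fin n)) :
    wordCoeff K _ (cayleyPermanentGraph K G) w =
      if ∃ σ : Equiv.Perm (Fin n), (∀ i, G.Adj i (σ i)) ∧ w = rowWord σ then 1 else 0 := by
  rw [cayleyPermanentGraph, cayleyPermanent, map_sum, Finset.sum_apply]
  have hterm : ∀ σ : Equiv.Perm (Fin n),
      wordCoeff K _ (List.ofFn fun i => weightedAdjMatrix K G i (σ i)).prod w =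
        if (∀ i, G.Adj i (σ i)) ∧ w = rowWord σ then 1 else 0 := fun σ => by
    refine (wordCoeff_prod_ofFn (fun i => G.Adj i (σ i)) (fun i => (i, σ i)) w).trans ?_
    congr
  rw [Finset.sum_congr rfl fun σ _ => hterm σ]
  by_cases h : ∃ σ : Equiv.Perm (Fin n), (∀ i, G.Adj i (σ i)) ∧ w = rowWord σ
  · obtain ⟨σ, hσ⟩ := h
    rw [if_pos ⟨σ, hσ⟩, Finset.sum_eq_single σ, if_pos hσ]
    · intro τ _ hτ
      refine if_neg fun h => hτ ?_
      exact DFunLike.coe_injective (rowWord_injective (h.2.symm.trans hσ.2))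
    · simp
  · rw [if_neg h]
    exact Finset.sum_eq_zero fun σ _ => if_neg fun hσ => h ⟨σ, hσ⟩

/-- The involution `π` restricted to the two-cycles marked by `T`: it swaps `i` and `π i` if
one of them lies in `T`, and fixes them otherwise. -/
def partialSwap {α : Type*} [DecidableEq α] (π : Equiv.Perm α) (T : Finset α) (i : α) : α :=
  if i ∈ T ∨ π i ∈ T then π i else i

theorem partialSwap_involutive {α : Type*} [DecidableEq α] {π : Equiv.Perm α}
    (hπ : ∀ i, π (π i) = i) (T : Finset α) : Function.Involutive (partialSwap π T) := by
  intro i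
  by_cases h : i ∈ T ∨ π i ∈ T
  · rw [partialSwap, partialSwap, if_pos h, hπ, if_pos h.symm]
  · rw [partialSwap, partialSwap, if_neg h, if_neg h]

/-- For a set `T` of two-cycles split by the middle cut, swapping exactly those in `T` gives a
monomial of the Cayley permanent. The first half of the monomial of `T` followed by the second
half of that of `U` is a monomial again only if `T = U`, which makes an identity matrix with rows
and columns indexed by the sets `T`. A set `T` is encoded by its points in the first half. -/
theorem two_pow_crossing_le_size {m : ℕ} {π : Equiv.Perm (Fin (m + m))}
    (hπ : π ∈ fpfInvolutions (Fin (m + m))) (P : ABP K (Fin (m + m) × Fin (m + m)))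
    (hP : P.poly = cayleyPermanentGraph K (involutionGraph π)) :
    2 ^ crossing π (Finset.univ.filter fun i => i.1 < m) ≤ P.size := by
  classical
  obtain ⟨hinv, hne⟩ := mem_fpfInvolutions.1 hπ
  let L : Finset (Fin (m + m)) := Finset.univ.filter fun i => i.1 < m
  let C : Finset (Fin (m + m)) := Finset.univ.filter fun i => i ∈ L ∧ π i ∉ L
  have hC : ∀ i, i ∈ C ↔ i.1 < m ∧ m ≤ (π i).1 := fun i => by simp [C, L]
  let word : C.powerset → List (Fin (m + m) × Fin (m + m)) := fun T => rowWord (partialSwap π T.1)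
  have hcard := P.card_le_size_of_wordCoeff (fun T => (word T).take m) (fun T => (word T).drop m)
    fun T U => ?_
  · rwa [Fintype.card_coe, Finset.card_powerset] at hcard
  -- The concatenation is the word of a function that follows `T` in the first half and `U` in the
  -- second one.
  let f : Fin (m + m) → Fin (m + m) := fun i =>
    if i.1 < m then partialSwap π T.1 i else partialSwap π U.1 i
  have hword : (word T).take m ++ (word U).drop m = rowWord f := by
    refine List.ext_getElem (by simp [word, rowWord]) fun i h₁ h₂ => ?_
    by_cases hi : i < m
    · rw [List.getElem_append_left (by simp [word, rowWord]; lia)]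
      simp [word, rowWord, f, hi]
    · rw [List.getElem_append_right (by simp [word, rowWord]; lia)]
      simp only [word, rowWord, f, List.getElem_drop, List.getElem_ofFn, List.length_take,
        List.length_ofFn, hi, if_false]
      have : m + (i - min m (m + m)) = i := by lia
      simp only [this]
  rw [hP, wordCoeff_cayleyPermanentGraph, hword]
  refine if_congr ⟨?_, ?_⟩ rfl rfl
  · rintro ⟨σ, -, hσ⟩
    have hσ : f = σ := rowWord_injective hσ
    have hinj : Function.Injective f := hσ ▸ σ.injective
    refine Subtype.ext (Finset.ext fun i => ?_)
    have hTC := Finset.mem_powerset.1 T.2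
    have hUC := Finset.mem_powerset.1 U.2
    by_cases hiC : i ∈ C
    · -- If `T` and `U` disagree at `i`, then `f` maps `i` and `π i` to the same point.
      obtain ⟨h1, h2⟩ := (hC i).1 hiC
      have hπi : π i ∉ C := fun h => absurd ((hC _).1 h).1 (not_lt.2 h2)
      have hπT : π i ∉ T.1 := fun h => hπi (hTC h)
      have hπU : π i ∉ U.1 := fun h => hπi (hUC h)
      have hfi : f i = if i ∈ T.1 then π i else i := by
        simp [f, partialSwap, h1, hπT]
      have hfπ : f (π i) = if i ∈ U.1 then i else π i := by
        simp [f, partialSwap, not_lt.2 h2, hinv, hπU]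
      have hfne : f i ≠ f (π i) := fun h => hne i (hinj h).symm
      rw [hfi, hfπ] at hfne
      by_cases hT : i ∈ T.1 <;> by_cases hU : i ∈ U.1 <;> simp [hT, hU] at hfne ⊢
    · exact ⟨fun h => absurd (hTC h) hiC, fun h => absurd (hUC h) hiC⟩
  · rintro rfl
    refine ⟨(partialSwap_involutive hinv T.1).toPerm, fun i => ?_, ?_⟩
    · change partialSwap π T.1 i = i ∨ partialSwap π T.1 i = π i
      unfold partialSwap
      split_ifs <;> simp
    · congr 1
      funext i
      simp [f]

/-- The empty word and the word of the identity give a submatrix of rank two. -/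
theorem two_le_size {n : ℕ} (hn : 0 < n) (π : Equiv.Perm (Fin n))
    (P : ABP K (Fin n × Fin n))
    (hP : P.poly = cayleyPermanentGraph K (involutionGraph π)) : 2 ≤ P.size := by
  classical
  let w : List (Fin n × Fin n) := rowWord id
  have hlen : ∀ f : Fin n → Fin n, (rowWord f).length = n := fun f => by simp [rowWord]
  have hwlen : w.length = n := hlen id
  have h0 : ∀ v : List (Fin n × Fin n), v.length ≠ n →
      wordCoeff K _ (cayleyPermanentGraph K (involutionGraph π)) v = 0 := by
    intro v hv
    rw [wordCoeff_cayleyPermanentGraph]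
    refine if_neg ?_
    rintro ⟨σ, -, rfl⟩
    exact hv (hlen σ)
  have h1 : wordCoeff K _ (cayleyPermanentGraph K (involutionGraph π)) w = 1 := by
    rw [wordCoeff_cayleyPermanentGraph]
    exact if_pos ⟨1, fun i => Or.inl rfl, rfl⟩
  have hcard := P.card_le_size_of_wordCoeff (ι := Bool) (fun b => if b then w else [])
    (fun b => if b then [] else w) fun b c => ?_
  · simpa using hcard
  rw [hP]
  cases b <;> cases c
  · simpa using h1
  · simpa using h0 [] (by simp; lia)
  · simpa using h0 (w ++ w) (by simp [hwlen]; lia)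
  · simpa using h1

end TwoCycles

theorem involutionGraph_injOn {n : ℕ} :
    Set.InjOn involutionGraph (fpfInvolutions (Fin n) : Set (Equiv.Perm (Fin n))) := by
  intro π hπ ρ _ h
  ext1 i
  have : (involutionGraph ρ).Adj i (π i) := h ▸ Or.inr rfl
  exact this.resolve_left ((mem_fpfInvolutions.1 hπ).2 i)

theorem twoCycleGraphs_eq_image (n : ℕ) :
    twoCycleGraphs n = involutionGraph '' (fpfInvolutions (Fin n) : Set (Equiv.Perm (Fin n))) := by
  ext G
  constructor
  · rintro ⟨π, h1, h2, rfl⟩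
    exact ⟨π, mem_fpfInvolutions.2 ⟨h1, h2⟩, rfl⟩
  · rintro ⟨π, hπ, rfl⟩
    exact ⟨π, (mem_fpfInvolutions.1 hπ).1, (mem_fpfInvolutions.1 hπ).2, rfl⟩

theorem ncard_twoCycleGraphs (n : ℕ) :
    (twoCycleGraphs n).ncard = (fpfInvolutions (Fin n)).card := by
  rw [twoCycleGraphs_eq_image, involutionGraph_injOn.ncard_image,
    Set.ncard_coe_finset]

theorem theorem4 :
    ∃ c : ℝ, 0 < c ∧ ∀ n : ℕ, Even n → 0 < n →
      (({G ∈ twoCycleGraphs n |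
          ¬ ∀ (K : Type u) [Field K] (P : ABP K (Fin n × Fin n)),
            P.poly = cayleyPermanentGraph K G → (2 : ℝ) ^ (c * (n : ℝ)) ≤ (P.size : ℝ)}.ncard : ℕ) : ℝ)
        ≤ (1 / √(n : ℝ)) * ((twoCycleGraphs n).ncard : ℝ) := by
  refine ⟨1 / 40, by norm_num, fun n hn hpos => ?_⟩
  obtain ⟨m, rfl⟩ := hn
  rcases le_total m 20 with hm | hm
  · -- Here `2 ^ (c * n) ≤ 2`, and no graph is exceptional.
    have hm' : (m : ℝ) ≤ 20 := by exact_mod_cast hm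
    refine le_of_eq_of_le (b := 0) ?_ (by positivity)
    rw [Nat.cast_eq_zero]
    refine (congrArg Set.ncard (Set.eq_empty_of_forall_notMem ?_)).trans (Set.ncard_empty _)
    rintro _ ⟨⟨π, -, -, rfl⟩, hbad⟩
    refine hbad fun K _ P hP => ?_
    have h2 : (2 : ℝ) ≤ P.size := by exact_mod_cast two_le_size hpos π P hP
    refine le_trans ?_ h2
    calc (2 : ℝ) ^ (1 / 40 * ((m + m : ℕ) : ℝ)) ≤ 2 ^ (1 : ℝ) :=
          Real.rpow_le_rpow_of_exponent_le one_le_two (by push_cast; linarith)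
      _ = 2 := Real.rpow_one 2
  · let L : Finset (Fin (m + m)) := Finset.univ.filter fun i => i.1 < m
    have hL : L.card = m := by
      simp [L, Fin.card_filter_val_lt]
    let few := (fpfInvolutions (Fin (m + m))).filter fun π => 8 * crossing π L ≤ m
    have hsub : {G ∈ twoCycleGraphs (m + m) |
        ¬ ∀ (K : Type u) [Field K] (P : ABP K (Fin (m + m) × Fin (m + m))),
          P.poly = cayleyPermanentGraph K G →
            (2 : ℝ) ^ (1 / 40 * ((m + m : ℕ) : ℝ)) ≤ (P.size : ℝ)} ⊆
        involutionGraph '' (few : Set (Equiv.Perm (Fin (m + m)))) := by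
      rintro G ⟨hG, hbad⟩
      rw [twoCycleGraphs_eq_image] at hG
      obtain ⟨π, hπ, rfl⟩ := hG
      refine ⟨π, Finset.mem_filter.2 ⟨hπ, ?_⟩, rfl⟩
      by_contra hcross
      refine hbad fun K _ P hP => ?_
      have hcross' : (m : ℝ) ≤ 8 * crossing π L := by exact_mod_cast (not_le.1 hcross).le
      calc (2 : ℝ) ^ (1 / 40 * ((m + m : ℕ) : ℝ)) ≤ 2 ^ (crossing π L : ℝ) :=
            Real.rpow_le_rpow_of_exponent_le one_le_two (by push_cast; linarith)
        _ = ((2 ^ crossing π L : ℕ) : ℝ) := by rw [Real.rpow_natCast]; norm_cast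
        _ ≤ P.size := by exact_mod_cast two_pow_crossing_le_size hπ P hP
    have hcard := (Set.ncard_le_ncard hsub).trans (Set.ncard_image_le few.finite_toSet)
    rw [Set.ncard_coe_finset] at hcard
    rw [ncard_twoCycleGraphs]
    calc _ ≤ (few.card : ℝ) := by exact_mod_cast hcard
      _ ≤ _ := by exact_mod_cast card_few_crossing_le hm hL
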